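/- A real vector $(y_1,\dots,y_m)$ is called $x$-alternating if $(-1)^j(y_j-y_{j+1})\ge x$ for all $1\le j\le m-1$ (vectors of length at most $1$ are $x$-alternating). For $\mathbf y\in\mathbb R^n$ let $L_{n,x}(\mathbf y)$ be the length of the longest $x$-alternating subsequence of $\mathbf y$. Let $0\le x<1$, and let $\mathbf y$ be distributed according to product Lebesgue measure on $[0,1]^n$. Put $$b_j=\binom nj(1-x)^j x^{n-j}\qquad(b_j=0\text{ for }j>n),$$ $$\varepsilon_1(n,x)=\tfrac56 b_0+\tfrac16 b_1,\qquad \varepsilon_2(n,x)=\tfrac{47}{45}b_0+\tfrac15 b_1-\tfrac1{30}b_2+\tfrac1{90}b_3 .$$ Then for every $n\ge1$ the function $L_{n,x}$ is measurable and $$\mathbb E L_{n,x}=\tfrac23 n(1-x)+\tfrac16+\varepsilon_1(n,x),$$ $$\operatorname{Var}L_{n,x}=(1-x)(2+5x)\frac{4n}{45}-\frac{13}{180}+\varepsilon_2(n,x)-2\left(\tfrac23n(1-x)+\tfrac16\right)\varepsilon_1(n,x)-\varepsilon_1(n,x)^2 .$$ In particular, for fixed $x\in[0,1)$, as $n\to\infty$,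 $$\mathbb E L_{n,x}-\left(\tfrac23 n(1-x)+\tfrac16\right)\to0,\qquad \operatorname{Var}L_{n,x}-\left((1-x)(2+5x)\frac{4n}{45}-\frac{13}{180}\right)\to0 .$$ -/

import Mathlib

open MeasureTheory ProbabilityTheory Filter Topology

/-- A real vector `(y_1, …, y_m)` is `x`-alternating if `(-1)^j (y_j - y_{j+1}) ≥ x` for all
`1 ≤ j ≤ m - 1`: the first step goes up, and every step has size at least `x`.
(Coordinates are indexed from `0` here, so the coordinate `y_j` is `y ⟨j - 1, _⟩`.) -/
def IsXAlternating (x : ℝ) {m : ℕ} (y : Fin m → ℝ) : Prop :=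
  ∀ (i : ℕ) (hi : i + 1 < m), x ≤ (-1) ^ (i + 1) * (y ⟨i, by omega⟩ - y ⟨i + 1, hi⟩)

/-- The length of the longest `x`-alternating subsequence of `y`. The set of lengths
contains `0` and is bounded by `n`. -/
noncomputable def longestXAlternating (x : ℝ) {n : ℕ} (y : Fin n → ℝ) : ℕ :=
  sSup {m : ℕ | ∃ f : Fin m ↪o Fin n, IsXAlternating x (y ∘ f)}

/-- Product Lebesgue measure on the cube `[0,1]^n`. -/
noncomputable def cubeMeasure (n : ℕ) : Measure (Fin n → ℝ) :=
  Measure.pi fun _ => volume.restrict (Set.Icc (0 : ℝ) 1)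

/-- The expectation of `L_{n,x}`. -/
noncomputable def meanL (n : ℕ) (x : ℝ) : ℝ :=
  ∫ y, (longestXAlternating x y : ℝ) ∂(cubeMeasure n)

/-- The variance of `L_{n,x}`. -/
noncomputable def varL (n : ℕ) (x : ℝ) : ℝ :=
  variance (fun y => (longestXAlternating x y : ℝ)) (cubeMeasure n)

/-- The probability that a binomial variable with parameters `n` and `1 - x` equals `j`. -/
def binomialProb (n : ℕ) (x : ℝ) (j : ℕ) : ℝ :=
  (n.choose j : ℝ) * (1 - x) ^ j * x ^ (n - j)

/-- The contribution of small values of the binomial variable to the first moment. -/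
noncomputable def firstMomentCorrection (n : ℕ) (x : ℝ) : ℝ :=
  5 / 6 * binomialProb n x 0 + 1 / 6 * binomialProb n x 1

/-- The contribution of small values of the binomial variable to the second moment. -/
noncomputable def secondMomentCorrection (n : ℕ) (x : ℝ) : ℝ :=
  47 / 45 * binomialProb n x 0 + 1 / 5 * binomialProb n x 1
    - 1 / 30 * binomialProb n x 2 + 1 / 90 * binomialProb n x 3

/-! A greedy search computes the longest alternating subsequence: keep the running minimum `z`,
record a turn at the first entry at least `z + x`, then reflect by `t ↦ 1 - t` so that an ascent is
sought again (`isGreatest_turnCount`). For random entries this is a Markov chain on `z`, since the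
cube measure is invariant under reflection.

The threshold is removed by rescaling to `u = min (z / (1 - x)) 1`. Whatever the state, an entry
leaves `u` unchanged without a turn on a set of measure `x`; cutting this set out and stretching
what remains by `1 / (1 - x)` gives one step of the chain with threshold `0`. So the number of
effective entries is binomial with parameters `n`, `1 - x`, and every expectation is a binomial
average of threshold-zero expectations (`turnExpectation_eq_binomialMean`).

For quadratic statistics the threshold-zero expectations are polynomials in `u` of degree at most
four, with one closed form from four steps on (`zeroTurnExpectation_add_four_quadratic`). The
smaller step counts deviate from it, which is the source of the terms in `b_0, …, b_3`. Binomial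
moments finish the computation. -/

/-! ### Optimality of the greedy search -/

/-- The list version of `IsXAlternating`. -/
def AlternatingList (x : ℝ) (l : List ℝ) : Prop :=
  ∀ (i : ℕ) (hi : i + 1 < l.length), x ≤ (-1) ^ (i + 1) * (l[i] - l[i + 1])

theorem alternatingList_singleton (x a : ℝ) : AlternatingList x [a] := by
  intro i hi
  simp at hi

theorem alternatingList_cons_cons (x a b : ℝ) (l : List ℝ) :
    AlternatingList x (a :: b :: l) ↔
      a + x ≤ b ∧ AlternatingList x ((b :: l).map fun t => 1 - t) := by
  constructor
  · intro h
    refine ⟨?_, fun i hi => ?_⟩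
    · have := h 0 (by simp)
      simp at this
      linarith
    · have := h (i + 1) (by simpa using hi)
      simp only [List.getElem_cons_succ] at this
      simp only [List.getElem_map, List.getElem_cons_succ]
      refine this.trans (le_of_eq ?_)
      ring
  · rintro ⟨h1, h2⟩ i hi
    cases i with
    | zero =>
      simp
      linarith
    | succ i =>
      have := h2 i (by simpa using hi)
      simp only [List.getElem_map, List.getElem_cons_succ] at this
      simp only [List.getElem_cons_succ]
      refine this.trans (le_of_eq ?_)
      ring

/-- The first step must ascend, so a lower start only helps. This is the exchange argument behind
the greedy search. -/
theorem AlternatingList.head_anti {x a b : ℝ} {l : List ℝ} (hab : a ≤ b)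
    (h : AlternatingList x (b :: l)) : AlternatingList x (a :: l) := by
  cases l with
  | nil => exact alternatingList_singleton x a
  | cons c l =>
    rw [alternatingList_cons_cons] at h ⊢
    exact ⟨by linarith [h.1], h.2⟩

/-- The lengths of the `x`-alternating sublists of a list. -/
def alternatingLengths (x : ℝ) (l : List ℝ) : Set ℕ :=
  {k | ∃ w : List ℝ, w.Sublist l ∧ AlternatingList x w ∧ w.length = k}

/-- The head `z` is useless: it cannot precede `a`, and in front of anything else `a` does at least
as well. -/
theorem alternatingLengths_cons_cons_of_lt {x z a : ℝ} (hx : 0 ≤ x) (l : List ℝ) (h : a < z) :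
    alternatingLengths x (z :: a :: l) = alternatingLengths x (a :: l) := by
  ext k
  constructor
  · rintro ⟨w, hw, halt, rfl⟩
    rcases List.sublist_cons_iff.1 hw with hw | ⟨r, rfl, hr⟩
    · exact ⟨w, hw, halt, rfl⟩
    · rcases List.sublist_cons_iff.1 hr with hr | ⟨s, rfl, hs⟩
      · exact ⟨a :: r, hr.cons_cons a, halt.head_anti h.le, rfl⟩
      · have := ((alternatingList_cons_cons x z a s).1 halt).1
        linarith
  · rintro ⟨w, hw, halt, rfl⟩
    exact ⟨w, hw.cons z, halt, rfl⟩

/-- Here `a` is useless: it is too close to follow `z`, and as a head it can be replaced by the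
lower `z`. -/
theorem alternatingLengths_cons_cons_of_mem {x z a : ℝ} (l : List ℝ) (h : z ≤ a)
    (h' : a < z + x) :
    alternatingLengths x (z :: a :: l) = alternatingLengths x (z :: l) := by
  ext k
  constructor
  · rintro ⟨w, hw, halt, rfl⟩
    rcases List.sublist_cons_iff.1 hw with hw | ⟨r, rfl, hr⟩
    · rcases List.sublist_cons_iff.1 hw with hw | ⟨r, rfl, hr⟩
      · exact ⟨w, hw.cons z, halt, rfl⟩
      · exact ⟨z :: r, hr.cons_cons z, halt.head_anti h, rfl⟩
    · rcases List.sublist_cons_iff.1 hr with hr | ⟨s, rfl, hs⟩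
      · exact ⟨z :: r, hr.cons_cons z, halt, rfl⟩
      · have := ((alternatingList_cons_cons x z a s).1 halt).1
        linarith
  · rintro ⟨w, hw, halt, rfl⟩
    exact ⟨w, hw.trans ((List.sublist_cons_self a l).cons_cons z), halt, rfl⟩

/-- An optimal sublist of the reflected tail can be chosen so that `z` may be put in front of it.
The value `m + 1` guarantees that this sublist has a head. -/
theorem isGreatest_alternatingLengths_cons_cons {x z a : ℝ} {l : List ℝ} {m : ℕ}
    (h : z + x ≤ a)
    (hm : IsGreatest (alternatingLengths x ((a :: l).map fun t => 1 - t)) (m + 1)) :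
    IsGreatest (alternatingLengths x (z :: a :: l)) (m + 1 + 1) := by
  obtain ⟨⟨w, hw, halt, hlen⟩, hub⟩ := hm
  obtain ⟨v, hv, rfl⟩ := List.sublist_map_iff.1 hw
  constructor
  · rw [List.length_map] at hlen
    rcases List.sublist_cons_iff.1 hv with hvl | ⟨r, rfl, hr⟩
    · obtain ⟨b, r, rfl⟩ := List.exists_cons_of_length_eq_add_one hlen
      rcases le_or_gt (z + x) b with hb | hb
      · exact ⟨z :: b :: r, hv.cons_cons z,
          (alternatingList_cons_cons ..).2 ⟨hb, halt⟩, by simpa using hlen⟩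
      -- Now `b < z + x ≤ a`, so after reflection `1 - a` lies below `1 - b`, and `a` can replace
      -- `b` as head.
      · refine ⟨z :: a :: r, (((List.sublist_cons_self b r).trans hvl).cons_cons a).cons_cons z,
          (alternatingList_cons_cons ..).2 ⟨h, ?_⟩, by simpa using hlen⟩
        exact AlternatingList.head_anti (b := 1 - b) (by linarith) halt
    · exact ⟨z :: a :: r, hv.cons_cons z,
        (alternatingList_cons_cons ..).2 ⟨h, halt⟩, by simpa using hlen⟩
  · rintro k ⟨u, hu, hualt, rfl⟩
    rcases u with _ | ⟨b, _ | ⟨c, r⟩⟩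
    · simp
    · simp
    · have hcr : (c :: r).Sublist (a :: l) := hu.tail
      have := hub ⟨_, hcr.map _, ((alternatingList_cons_cons ..).1 hualt).2, rfl⟩
      simpa using this

/-- The number of turns of the greedy search for an `x`-alternating subsequence of
`z, y 0, y 1, …` that is looking for an ascent from the running minimum `z`. After each turn the
remaining sequence is reflected by `t ↦ 1 - t`. -/
noncomputable def turnCount (x : ℝ) : (n : ℕ) → ℝ → (Fin n → ℝ) → ℕ
  | 0, _, _ => 0
  | n + 1, z, y =>
    if y 0 < z then turnCount x n (y 0) (fun i => y i.succ)
    else if z + x ≤ y 0 then turnCount x n (1 - y 0) (fun i => 1 - y i.succ) + 1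
    else turnCount x n z (fun i => y i.succ)

theorem isGreatest_turnCount {x : ℝ} (hx : 0 ≤ x) (n : ℕ) (z : ℝ) (y : Fin n → ℝ) :
    IsGreatest (alternatingLengths x (z :: List.ofFn y)) (turnCount x n z y + 1) := by
  induction n generalizing z with
  | zero =>
    refine ⟨⟨[z], by simp, alternatingList_singleton x z, by simp [turnCount]⟩, ?_⟩
    rintro k ⟨w, hw, -, rfl⟩
    simpa [turnCount] using hw.length_le
  | succ n ih =>
    rw [List.ofFn_succ, turnCount]
    split_ifs with h1 h2
    · rw [alternatingLengths_cons_cons_of_lt hx _ h1]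
      exact ih _ _
    · apply isGreatest_alternatingLengths_cons_cons h2
      have := ih (1 - y 0) (fun i => 1 - y i.succ)
      rw [List.map_cons, List.map_ofFn]
      exact this
    · rw [alternatingLengths_cons_cons_of_mem _ (not_lt.1 h1) (not_le.1 h2)]
      exact ih _ _

theorem setOf_isXAlternating_eq (x : ℝ) {n : ℕ} (y : Fin n → ℝ) :
    {m : ℕ | ∃ f : Fin m ↪o Fin n, IsXAlternating x (y ∘ f)} =
      alternatingLengths x (List.ofFn y) := by
  ext m
  constructor
  · rintro ⟨f, hf⟩
    refine ⟨List.ofFn (y ∘ f), ?_, fun i hi => ?_, by simp⟩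
    · rw [List.sublist_iff_exists_fin_orderEmbedding_get_eq]
      refine ⟨((Fin.castOrderIso (by simp)).toOrderEmbedding.trans f).trans
        (Fin.castOrderIso (by simp)).toOrderEmbedding, fun ix => ?_⟩
      simp
      rfl
    · have := hf i (by simpa using hi)
      simpa using this
  · rintro ⟨w, hw, halt, rfl⟩
    obtain ⟨f, hf⟩ := List.sublist_iff_exists_fin_orderEmbedding_get_eq.1 hw
    refine ⟨f.trans (Fin.castOrderIso (by simp)).toOrderEmbedding, fun i hi => ?_⟩
    have h1 := hf ⟨i, by omega⟩
    have h2 := hf ⟨i + 1, hi⟩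
    simp only [List.get_eq_getElem, List.getElem_ofFn] at h1 h2
    have := halt i hi
    rw [h1, h2] at this
    exact this

theorem longestXAlternating_eq_turnCount {x : ℝ} (hx : 0 ≤ x) (n : ℕ) (y : Fin (n + 1) → ℝ) :
    longestXAlternating x y = turnCount x n (y 0) (fun i => y i.succ) + 1 := by
  rw [longestXAlternating, setOf_isXAlternating_eq, List.ofFn_succ]
  exact (isGreatest_turnCount hx n _ _).csSup_eq

/-! ### Integration over the cube and the one-step recursion -/

instance isProbabilityMeasure_cubeMeasure (n : ℕ) : IsProbabilityMeasure (cubeMeasure n) := by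
  have : IsProbabilityMeasure ((volume : Measure ℝ).restrict (Set.Icc (0 : ℝ) 1)) :=
    ⟨by simp⟩
  unfold cubeMeasure
  infer_instance

theorem integral_cubeMeasure_succ (n : ℕ) {f : (Fin (n + 1) → ℝ) → ℝ}
    (hf : Integrable f (cubeMeasure (n + 1))) :
    ∫ y, f y ∂(cubeMeasure (n + 1)) =
      ∫ a in Set.Icc (0 : ℝ) 1, ∫ t, f (Fin.cons a t) ∂(cubeMeasure n) := by
  have hmp := (measurePreserving_piFinSuccAbove
    (fun _ : Fin (n + 1) => (volume : Measure ℝ).restrict (Set.Icc (0 : ℝ) 1)) 0).symm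
  have hint := (hmp.integrable_comp_emb (MeasurableEquiv.measurableEmbedding _)).2 hf
  have h := hmp.integral_comp' f
  unfold cubeMeasure at *
  rw [← h]
  refine (integral_prod _ hint).trans ?_
  simp only [Function.comp_apply, MeasurableEquiv.piFinSuccAbove_symm_apply, Fin.insertNthEquiv,
    Equiv.coe_fn_mk, Fin.insertNth_zero]
  rfl

theorem measurePreserving_one_sub_cubeMeasure (n : ℕ) :
    MeasurePreserving (fun (y : Fin n → ℝ) i => 1 - y i) (cubeMeasure n) (cubeMeasure n) := by
  have h : MeasurePreserving (fun t : ℝ => 1 - t) (volume.restrict (Set.Icc (0 : ℝ) 1))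
      (volume.restrict (Set.Icc (0 : ℝ) 1)) := by
    have := (Measure.measurePreserving_sub_left (volume : Measure ℝ) 1).restrict_preimage
      (measurableSet_Icc (a := (0 : ℝ)) (b := 1))
    simpa using this
  exact measurePreserving_pi _ _ fun _ => h

theorem integral_one_sub_cubeMeasure (n : ℕ) (f : (Fin n → ℝ) → ℝ) :
    ∫ y, f (fun i => 1 - y i) ∂(cubeMeasure n) = ∫ y, f y ∂(cubeMeasure n) := by
  have hinv : Function.Involutive (fun (y : Fin n → ℝ) i => 1 - y i) := fun y => by simp
  let e : (Fin n → ℝ) ≃ᵐ (Fin n → ℝ) :=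
    { hinv.toPerm with
      measurable_toFun := (measurePreserving_one_sub_cubeMeasure n).measurable
      measurable_invFun := (measurePreserving_one_sub_cubeMeasure n).measurable }
  exact MeasurePreserving.integral_comp' (f := e) (measurePreserving_one_sub_cubeMeasure n) f

/-- Joint measurability is needed because the recursion feeds entries of `y` into the running
minimum. -/
theorem measurable_uncurry_turnCount (x : ℝ) (n : ℕ) :
    Measurable fun p : ℝ × (Fin n → ℝ) => turnCount x n p.1 p.2 := by
  induction n with
  | zero => exact measurable_const
  | succ n ih =>
    simp only [turnCount]
    refine Measurable.ite (measurableSet_lt (by fun_prop) (by fun_prop)) ?_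
      (Measurable.ite (measurableSet_le (by fun_prop) (by fun_prop)) ?_ ?_)
    · exact ih.comp (f := fun p : ℝ × (Fin (n + 1) → ℝ) => (p.2 0, fun i => p.2 (Fin.succ i)))
        (by fun_prop)
    · exact (ih.comp (f := fun p : ℝ × (Fin (n + 1) → ℝ) =>
        (1 - p.2 0, fun i => 1 - p.2 (Fin.succ i))) (by fun_prop)).add_const 1
    · exact ih.comp (f := fun p : ℝ × (Fin (n + 1) → ℝ) => (p.1, fun i => p.2 (Fin.succ i)))
        (by fun_prop)

theorem measurable_turnCount (x : ℝ) (n : ℕ) (z : ℝ) : Measurable (turnCount x n z) :=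
  (measurable_uncurry_turnCount x n).comp (f := fun y => (z, y)) (by fun_prop)

theorem measurable_longestXAlternating {x : ℝ} (hx : 0 ≤ x) (n : ℕ) :
    Measurable (fun y : Fin (n + 1) → ℝ => longestXAlternating x y) := by
  simp only [longestXAlternating_eq_turnCount hx]
  exact ((measurable_uncurry_turnCount x n).comp
    (f := fun y : Fin (n + 1) → ℝ => (y 0, fun i => y (Fin.succ i))) (by fun_prop)).add_const 1

theorem turnCount_le (x : ℝ) (n : ℕ) (z : ℝ) (y : Fin n → ℝ) : turnCount x n z y ≤ n := by
  induction n generalizing z with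
  | zero => simp [turnCount]
  | succ n ih =>
    rw [turnCount]
    split_ifs
    · exact (ih _ _).trans (Nat.le_succ n)
    · exact Nat.succ_le_succ (ih _ _)
    · exact (ih _ _).trans (Nat.le_succ n)

theorem integrable_comp_of_le {α : Type*} [MeasurableSpace α] {μ : Measure α}
    [IsFiniteMeasure μ] {f : α → ℕ} (hf : Measurable f) {n : ℕ} (hn : ∀ a, f a ≤ n)
    (g : ℕ → ℝ) : Integrable (fun a => g (f a)) μ := by
  refine Integrable.of_bound (C := ∑ k ∈ Finset.range (n + 1), |g k|)
    ((measurable_from_nat (f := g)).comp hf).aestronglyMeasurable (ae_of_all _ fun a => ?_)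
  exact Finset.single_le_sum (f := fun k => |g k|) (fun k _ => abs_nonneg _)
    (Finset.mem_range.2 (Nat.lt_succ_of_le (hn a)))

/-- The expectation of `g` of the number of turns, started from the running minimum `z`. -/
noncomputable def turnExpectation (x : ℝ) (n : ℕ) (g : ℕ → ℝ) (z : ℝ) : ℝ :=
  ∫ y, g (turnCount x n z y) ∂(cubeMeasure n)

/-- Condition on the first entry; the reflection of the later entries is absorbed by the symmetry of
the cube. -/
theorem turnExpectation_succ (x : ℝ) (n : ℕ) (g : ℕ → ℝ) (z : ℝ) :
    turnExpectation x (n + 1) g z = ∫ a in Set.Icc (0 : ℝ) 1,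
      if a < z then turnExpectation x n g a
      else if z + x ≤ a then turnExpectation x n (fun s => g (s + 1)) (1 - a)
      else turnExpectation x n g z := by
  rw [turnExpectation, integral_cubeMeasure_succ _
    (integrable_comp_of_le (measurable_turnCount x _ z) (turnCount_le x _ z) g)]
  congr 1
  ext a
  simp only [turnCount, Fin.cons_zero, Fin.cons_succ]
  split_ifs
  · rfl
  · exact integral_one_sub_cubeMeasure n fun y => g (turnCount x n (1 - a) y + 1)
  · rfl

theorem longestXAlternating_le {x : ℝ} (hx : 0 ≤ x) (n : ℕ) (y : Fin (n + 1) → ℝ) :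
    longestXAlternating x y ≤ n + 1 := by
  rw [longestXAlternating_eq_turnCount hx]
  exact Nat.succ_le_succ (turnCount_le ..)

/-- From the running minimum `1` the first entry almost surely just becomes the new minimum, so no
separate initial step is needed. The endpoint `a = 1`, where this fails, is null. -/
theorem integral_longestXAlternating {x : ℝ} (hx : 0 ≤ x) (n : ℕ) (g : ℕ → ℝ) :
    ∫ y, g (longestXAlternating x y) ∂(cubeMeasure (n + 1)) =
      turnExpectation x (n + 1) (fun s => g (s + 1)) 1 := by
  rw [integral_cubeMeasure_succ _
    (integrable_comp_of_le (measurable_longestXAlternating hx n)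
      (longestXAlternating_le hx n) g), turnExpectation_succ,
    integral_Icc_eq_integral_Ico, integral_Icc_eq_integral_Ico]
  refine setIntegral_congr_fun measurableSet_Ico fun a ha => ?_
  simp only [if_pos ha.2, longestXAlternating_eq_turnCount hx, Fin.cons_zero, Fin.cons_succ]
  rfl

/-! ### Threshold zero and binomial averages -/

/-- The expectation of `g` of the number of turns after `k` steps for the threshold `x = 0`. -/
noncomputable def zeroTurnExpectation : ℕ → (ℕ → ℝ) → ℝ → ℝ
  | 0, g, _ => g 0
  | k + 1, g, u => (∫ v in (0 : ℝ)..u, zeroTurnExpectation k g v) +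
      ∫ v in (0 : ℝ)..(1 - u), zeroTurnExpectation k (fun s => g (s + 1)) v

theorem continuous_zeroTurnExpectation (k : ℕ) (g : ℕ → ℝ) :
    Continuous (zeroTurnExpectation k g) := by
  induction k generalizing g with
  | zero => exact continuous_const
  | succ k ih =>
    have h : ∀ g, Continuous fun u : ℝ => ∫ v in (0 : ℝ)..u, zeroTurnExpectation k g v :=
      fun g => intervalIntegral.continuous_primitive
        (fun a b => (ih g).intervalIntegrable a b) 0
    exact (h g).add ((h _).comp (f := fun u : ℝ => 1 - u) (by fun_prop))

theorem binomialProb_zero_succ (n : ℕ) (x : ℝ) :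
    binomialProb (n + 1) x 0 = x * binomialProb n x 0 := by
  simp [binomialProb, pow_succ']

theorem binomialProb_eq_zero_of_lt {n j : ℕ} (x : ℝ) (h : n < j) : binomialProb n x j = 0 := by
  simp [binomialProb, Nat.choose_eq_zero_of_lt h]

theorem binomialProb_succ_succ (n : ℕ) (x : ℝ) (k : ℕ) :
    binomialProb (n + 1) x (k + 1) =
      x * binomialProb n x (k + 1) + (1 - x) * binomialProb n x k := by
  rcases lt_or_ge k n with h | h
  · obtain ⟨m, rfl⟩ := Nat.exists_eq_add_of_lt h
    have h1 : k + m + 1 + 1 - (k + 1) = m + 1 := by omega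
    have h2 : k + m + 1 - (k + 1) = m := by omega
    have h3 : k + m + 1 - k = m + 1 := by omega
    rw [binomialProb, binomialProb, binomialProb, h1, h2, h3, Nat.choose_succ_succ]
    push_cast
    ring
  · rw [binomialProb_eq_zero_of_lt x (Nat.lt_succ_of_le h), binomialProb, binomialProb,
      Nat.choose_succ_succ, Nat.choose_eq_zero_of_lt (Nat.lt_succ_of_le h)]
    simp
    ring

/-- The mean of `a` under the binomial distribution with parameters `n` and `1 - x`. -/
noncomputable def binomialMean (n : ℕ) (x : ℝ) (a : ℕ → ℝ) : ℝ :=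
  ∑ k ∈ Finset.range (n + 1), binomialProb n x k * a k

theorem binomialMean_zero (x : ℝ) (a : ℕ → ℝ) : binomialMean 0 x a = a 0 := by
  simp [binomialMean, binomialProb]

/-- Condition on one Bernoulli trial, which succeeds with probability `1 - x`. -/
theorem binomialMean_succ (n : ℕ) (x : ℝ) (a : ℕ → ℝ) :
    binomialMean (n + 1) x a =
      x * binomialMean n x a + (1 - x) * binomialMean n x fun k => a (k + 1) := by
  have h : binomialMean n x a =
      ∑ k ∈ Finset.range (n + 2), binomialProb n x k * a k := by
    rw [Finset.sum_range_succ, binomialProb_eq_zero_of_lt x (Nat.lt_succ_self n), zero_mul,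
      add_zero, binomialMean]
  rw [h, binomialMean, binomialMean, Finset.sum_range_succ', Finset.sum_range_succ' _ (n + 1),
    mul_add, Finset.mul_sum, Finset.mul_sum, binomialProb_zero_succ, add_right_comm,
    ← Finset.sum_add_distrib, mul_assoc]
  congr 1
  refine Finset.sum_congr rfl fun k _ => ?_
  rw [binomialProb_succ_succ]
  ring

theorem integral_binomialMean (n : ℕ) (x : ℝ) {a : ℕ → ℝ → ℝ} (ha : ∀ k, Continuous (a k))
    (s t : ℝ) : ∫ v in s..t, binomialMean n x (fun k => a k v) =
      binomialMean n x fun k => ∫ v in s..t, a k v := by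
  simp only [binomialMean]
  rw [intervalIntegral.integral_finsetSum
    fun k _ => ((ha k).const_mul _).intervalIntegrable s t]
  simp only [intervalIntegral.integral_const_mul]

theorem binomialMean_add (n : ℕ) (x : ℝ) (a b : ℕ → ℝ) :
    binomialMean n x (fun k => a k + b k) = binomialMean n x a + binomialMean n x b := by
  simp only [binomialMean, mul_add, Finset.sum_add_distrib]

theorem continuous_binomialMean_zeroTurnExpectation (n : ℕ) (x : ℝ) (g : ℕ → ℝ) :
    Continuous fun u => binomialMean n x fun k => zeroTurnExpectation k g u :=
  continuous_finsetSum _ fun k _ => (continuous_zeroTurnExpectation k g).const_mul _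

/-- This is the recursion that the rescaled chain has to match: with weight `x` nothing happens,
with weight `1 - x` a threshold-zero step is made. -/
theorem binomialMean_zeroTurnExpectation_succ (n : ℕ) (x : ℝ) (g : ℕ → ℝ) (u : ℝ) :
    binomialMean (n + 1) x (fun k => zeroTurnExpectation k g u) =
      x * binomialMean n x (fun k => zeroTurnExpectation k g u) + (1 - x) *
        ((∫ v in (0 : ℝ)..u, binomialMean n x fun k => zeroTurnExpectation k g v) +
          ∫ v in (0 : ℝ)..(1 - u), binomialMean n x fun k =>
            zeroTurnExpectation k (fun s => g (s + 1)) v) := by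
  rw [binomialMean_succ, integral_binomialMean n x (continuous_zeroTurnExpectation · g),
    integral_binomialMean n x (continuous_zeroTurnExpectation · _), ← binomialMean_add]
  rfl

/-! ### Reduction to threshold zero -/

theorem setIntegral_Icc_eq_of_piecewise {f A B : ℝ → ℝ} {z w C : ℝ} (hz : 0 ≤ z) (hzw : z ≤ w)
    (hw : w ≤ 1) (hA : Continuous A) (hB : Continuous B) (h1 : ∀ a ∈ Set.Ico 0 z, f a = A a)
    (h2 : ∀ a ∈ Set.Ico z w, f a = C) (h3 : ∀ a ∈ Set.Ico w 1, f a = B a) :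
    ∫ a in Set.Icc (0 : ℝ) 1, f a =
      (∫ a in (0 : ℝ)..z, A a) + (w - z) * C + ∫ a in w..1, B a := by
  have i1 : IntegrableOn f (Set.Ico 0 z) :=
    ((hA.integrableOn_Icc (a := 0) (b := z)).mono_set Set.Ico_subset_Icc_self).congr_fun
      (fun a ha => (h1 a ha).symm) measurableSet_Ico
  have i2 : IntegrableOn f (Set.Ico z w) :=
    (((continuous_const (y := C)).integrableOn_Icc (a := z) (b := w)).mono_set
      Set.Ico_subset_Icc_self).congr_fun (fun a ha => (h2 a ha).symm) measurableSet_Ico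
  have i3 : IntegrableOn f (Set.Ico w 1) :=
    ((hB.integrableOn_Icc (a := w) (b := 1)).mono_set Set.Ico_subset_Icc_self).congr_fun
      (fun a ha => (h3 a ha).symm) measurableSet_Ico
  have hd1 : Disjoint (Set.Ico 0 z ∪ Set.Ico z w) (Set.Ico w 1) := by
    rw [Set.Ico_union_Ico_eq_Ico hz hzw]
    exact Set.Ico_disjoint_Ico_same
  rw [integral_Icc_eq_integral_Ico, ← Set.Ico_union_Ico_eq_Ico (hz.trans hzw) hw,
    ← Set.Ico_union_Ico_eq_Ico hz hzw, setIntegral_union hd1 measurableSet_Ico (i1.union i2) i3,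
    setIntegral_union Set.Ico_disjoint_Ico_same measurableSet_Ico i1 i2,
    setIntegral_congr_fun measurableSet_Ico h1, setIntegral_congr_fun measurableSet_Ico h2,
    setIntegral_congr_fun measurableSet_Ico h3, intervalIntegral.integral_of_le hz,
    intervalIntegral.integral_of_le hw, integral_Ico_eq_integral_Ioc,
    integral_Ico_eq_integral_Ioc (x := w)]
  simp [hzw]

theorem integral_comp_min_div_one_of_le {h : ℝ → ℝ} {c s : ℝ} (hc : 0 < c) (hs : 0 ≤ s)
    (hsc : s ≤ c) :
    ∫ a in (0 : ℝ)..s, h (min (a / c) 1) = c * ∫ v in (0 : ℝ)..(s / c), h v := by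
  rw [intervalIntegral.integral_congr (g := fun a => h (a / c)),
    intervalIntegral.integral_comp_div _ hc.ne', zero_div, smul_eq_mul]
  intro a ha
  rw [Set.uIcc_of_le hs] at ha
  simp only [min_eq_left ((div_le_one hc).2 (ha.2.trans hsc))]

theorem integral_comp_min_div_one_of_ge {h : ℝ → ℝ} (hh : Continuous h) {c s : ℝ} (hc : 0 < c)
    (hsc : c ≤ s) :
    ∫ a in (0 : ℝ)..s, h (min (a / c) 1) = c * (∫ v in (0 : ℝ)..1, h v) + (s - c) * h 1 := by
  have hcont : Continuous fun a => h (min (a / c) 1) := by fun_prop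
  rw [← intervalIntegral.integral_add_adjacent_intervals (hcont.intervalIntegrable 0 c)
    (hcont.intervalIntegrable c s), integral_comp_min_div_one_of_le hc hc.le le_rfl,
    div_self hc.ne', intervalIntegral.integral_congr (a := c) (g := fun _ => h 1)]
  · simp
  · intro a ha
    rw [Set.uIcc_of_le hsc] at ha
    simp only [min_eq_right ((one_le_div hc).2 ha.1)]

theorem turnExpectation_eq_binomialMean {x : ℝ} (hx0 : 0 ≤ x) (hx1 : x < 1) (n : ℕ)
    (g : ℕ → ℝ) {z : ℝ} (hz : z ∈ Set.Icc (0 : ℝ) 1) :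
    turnExpectation x n g z =
      binomialMean n x fun k => zeroTurnExpectation k g (min (z / (1 - x)) 1) := by
  have hc : 0 < 1 - x := sub_pos.2 hx1
  induction n generalizing g z with
  | zero => simp [turnExpectation, turnCount, binomialMean_zero, zeroTurnExpectation]
  | succ n ih =>
    obtain ⟨hz0, hz1⟩ := hz
    set H : (ℕ → ℝ) → ℝ → ℝ := fun g u =>
      binomialMean n x fun k => zeroTurnExpectation k g u with hH
    have hHc : ∀ g, Continuous (H g) := continuous_binomialMean_zeroTurnExpectation n x
    have hih : ∀ g, ∀ z ∈ Set.Icc (0 : ℝ) 1,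
        turnExpectation x n g z = H g (min (z / (1 - x)) 1) := fun g z hz => ih g hz
    have hzw : z ≤ min (z + x) 1 := le_min (by linarith) hz1
    have hcont : ∀ g, Continuous fun a => H g (min (a / (1 - x)) 1) := fun g =>
      (hHc g).comp (by fun_prop)
    rw [turnExpectation_succ, binomialMean_zeroTurnExpectation_succ,
      setIntegral_Icc_eq_of_piecewise hz0 hzw (min_le_right _ _) (hcont g)
        ((hcont fun s => g (s + 1)).comp (continuous_sub_left 1))
        (C := H g (min (z / (1 - x)) 1))]
    · simp only [Function.comp_def]
      rw [intervalIntegral.integral_comp_sub_left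
        (fun a => H (fun s => g (s + 1)) (min (a / (1 - x)) 1)), sub_self]
      change _ = x * H g _ + (1 - x) * ((∫ v in (0 : ℝ)..(min (z / (1 - x)) 1), H g v) +
        ∫ v in (0 : ℝ)..(1 - min (z / (1 - x)) 1), H (fun s => g (s + 1)) v)
      rcases le_total z (1 - x) with h | h
      -- The idle window `[z, z + x)` has length `x`; the intervals on either side, of lengths `z`
      -- and `1 - x - z`, scale to `u` and `1 - u`.
      · rw [min_eq_left (by linarith : z + x ≤ 1), min_eq_left ((div_le_one hc).2 h),
          integral_comp_min_div_one_of_le hc hz0 h,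
          integral_comp_min_div_one_of_le hc (by linarith) (by linarith)]
        have : (1 - (z + x)) / (1 - x) = 1 - z / (1 - x) := by
          field_simp
          ring
        rw [this]
        ring
      -- No ascent fits above `z`. Entries in `[1 - x, z)` lower the minimum but leave `u = 1`, so
      -- together with `[z, 1]` the idle set again has length `x`.
      · rw [min_eq_right (by linarith : 1 ≤ z + x), min_eq_right ((one_le_div hc).2 h),
          integral_comp_min_div_one_of_ge (hHc g) hc h]
        simp
        ring
    · intro a ha
      rw [if_pos ha.2, hih g a ⟨ha.1, ha.2.le.trans hz1⟩]
    · intro a ha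
      rw [if_neg (not_lt.2 ha.1), if_neg (not_le.2 (ha.2.trans_le (min_le_left _ _))),
        hih g z ⟨hz0, hz1⟩]
    · intro a ha
      have hxa : z + x ≤ a := (min_le_iff.1 ha.1).resolve_right (not_le.2 ha.2)
      rw [if_neg (by linarith), if_pos hxa, hih _ (1 - a) ⟨by linarith [ha.2], by linarith⟩]
      rfl

theorem integral_longestXAlternating_eq_binomialMean {x : ℝ} (hx0 : 0 ≤ x) (hx1 : x < 1)
    (n : ℕ) (g : ℕ → ℝ) :
    ∫ y, g (longestXAlternating x y) ∂(cubeMeasure (n + 1)) =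
      binomialMean (n + 1) x fun k => zeroTurnExpectation k (fun s => g (s + 1)) 1 := by
  rw [integral_longestXAlternating hx0, turnExpectation_eq_binomialMean hx0 hx1 _ _ (by simp),
    min_eq_right ((one_le_div (by linarith)).2 (by linarith))]

/-! ### Closed forms for quadratic statistics -/

theorem integral_quartic (a b c d e s : ℝ) :
    ∫ v in (0 : ℝ)..s, (a + b * v + c * v ^ 2 + d * v ^ 3 + e * v ^ 4) =
      a * s + b / 2 * s ^ 2 + c / 3 * s ^ 3 + d / 4 * s ^ 4 + e / 5 * s ^ 5 := by
  have h : ∀ v ∈ Set.uIcc 0 s, HasDerivAt (fun v : ℝ =>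
      a * v + b / 2 * v ^ 2 + c / 3 * v ^ 3 + d / 4 * v ^ 4 + e / 5 * v ^ 5)
      (a + b * v + c * v ^ 2 + d * v ^ 3 + e * v ^ 4) v := fun v _ => by
    have := (((((hasDerivAt_id v).const_mul a).add ((hasDerivAt_pow 2 v).const_mul (b / 2))).add
      ((hasDerivAt_pow 3 v).const_mul (c / 3))).add
      ((hasDerivAt_pow 4 v).const_mul (d / 4))).add ((hasDerivAt_pow 5 v).const_mul (e / 5))
    refine this.congr_deriv ?_
    norm_num
    ring
  rw [intervalIntegral.integral_eq_sub_of_hasDerivAt h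
    (Continuous.intervalIntegrable (by fun_prop) _ _)]
  simp

theorem zeroTurnExpectation_succ_of_quartic {k : ℕ} {g : ℕ → ℝ} {a b c d e a' b' c' d' e' : ℝ}
    (h : ∀ u, zeroTurnExpectation k g u = a + b * u + c * u ^ 2 + d * u ^ 3 + e * u ^ 4)
    (h' : ∀ u, zeroTurnExpectation k (fun s => g (s + 1)) u =
      a' + b' * u + c' * u ^ 2 + d' * u ^ 3 + e' * u ^ 4) (u : ℝ) :
    zeroTurnExpectation (k + 1) g u =
      (a * u + b / 2 * u ^ 2 + c / 3 * u ^ 3 + d / 4 * u ^ 4 + e / 5 * u ^ 5) +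
      (a' * (1 - u) + b' / 2 * (1 - u) ^ 2 + c' / 3 * (1 - u) ^ 3 + d' / 4 * (1 - u) ^ 4 +
        e' / 5 * (1 - u) ^ 5) := by
  simp only [zeroTurnExpectation, h, h', integral_quartic]

/-- A quadratic function of the number of turns. -/
def quadraticStatistic (α β γ : ℝ) (s : ℕ) : ℝ := α + β * s + γ * (s : ℝ) ^ 2

/-- One more turn keeps the statistic quadratic, so the recursion closes on the coefficients. The
leading coefficient `γ` is unchanged. -/
theorem quadraticStatistic_succ (α β γ : ℝ) :
    (fun s => quadraticStatistic α β γ (s + 1)) =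
      quadraticStatistic (α + β + γ) (β + 2 * γ) γ := by
  ext s
  simp only [quadraticStatistic]
  push_cast
  ring

theorem zeroTurnExpectation_zero_quadratic (α β γ u : ℝ) :
    zeroTurnExpectation 0 (quadraticStatistic α β γ) u =
      α + 0 * u + 0 * u ^ 2 + 0 * u ^ 3 + 0 * u ^ 4 := by
  simp [zeroTurnExpectation, quadraticStatistic]

theorem zeroTurnExpectation_one_quadratic (α β γ u : ℝ) :
    zeroTurnExpectation 1 (quadraticStatistic α β γ) u =
      (α + β + γ) + (-β - γ) * u + 0 * u ^ 2 + 0 * u ^ 3 + 0 * u ^ 4 := by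
  rw [zeroTurnExpectation_succ_of_quartic (zeroTurnExpectation_zero_quadratic α β γ)
    (by rw [quadraticStatistic_succ]; exact zeroTurnExpectation_zero_quadratic _ _ _)]
  ring

theorem zeroTurnExpectation_two_quadratic (α β γ u : ℝ) :
    zeroTurnExpectation 2 (quadraticStatistic α β γ) u =
      (α + 3 / 2 * β + 5 / 2 * γ) + 0 * u + (-β - 2 * γ) * u ^ 2 + 0 * u ^ 3 + 0 * u ^ 4 := by
  rw [zeroTurnExpectation_succ_of_quartic (zeroTurnExpectation_one_quadratic α β γ)
    (by rw [quadraticStatistic_succ]; exact zeroTurnExpectation_one_quadratic _ _ _)]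
  ring

theorem zeroTurnExpectation_three_quadratic (α β γ u : ℝ) :
    zeroTurnExpectation 3 (quadraticStatistic α β γ) u =
      (α + 13 / 6 * β + 31 / 6 * γ) + 0 * u + (-β - 4 * γ) * u ^ 2 + 2 / 3 * γ * u ^ 3 +
        0 * u ^ 4 := by
  rw [zeroTurnExpectation_succ_of_quartic (zeroTurnExpectation_two_quadratic α β γ)
    (by rw [quadraticStatistic_succ]; exact zeroTurnExpectation_two_quadratic _ _ _)]
  ring

/-- The degree stays at four: the `u ^ 4` coefficient `γ / 3` is the same for the shifted statistic,
so the quintic terms of the integrals over `[0, u]` and `[0, 1 - u]` cancel. The form starts at four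
steps because a cubic term survives at three. -/
theorem zeroTurnExpectation_add_four_quadratic (k : ℕ) (α β γ u : ℝ) :
    zeroTurnExpectation (k + 4) (quadraticStatistic α β γ) u =
      (α + (2 / 3 * (k + 4) + 1 / 6) * β +
          (4 / 9 * (k + 4) ^ 2 + 2 / 5 * (k + 4) - 2 / 45) * γ) + 0 * u +
        (-β - (4 / 3 * k + 5) * γ) * u ^ 2 + 0 * u ^ 3 + 1 / 3 * γ * u ^ 4 := by
  induction k generalizing α β γ u with
  | zero =>
    rw [zeroTurnExpectation_succ_of_quartic (zeroTurnExpectation_three_quadratic α β γ)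
      (by rw [quadraticStatistic_succ]; exact zeroTurnExpectation_three_quadratic _ _ _)]
    push_cast
    ring
  | succ k ih =>
    rw [Nat.add_right_comm, zeroTurnExpectation_succ_of_quartic (ih α β γ)
      (by rw [quadraticStatistic_succ]; exact ih _ _ _)]
    push_cast
    ring

/-! ### Binomial moments and the exact formulas -/

theorem binomialMean_smul (n : ℕ) (x c : ℝ) (a : ℕ → ℝ) :
    binomialMean n x (fun k => c * a k) = c * binomialMean n x a := by
  simp only [binomialMean, Finset.mul_sum]
  exact Finset.sum_congr rfl fun k _ => by ring

theorem binomialMean_one (n : ℕ) (x : ℝ) : (binomialMean n x fun _ => 1) = 1 := by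
  induction n with
  | zero => simp [binomialMean_zero]
  | succ n ih =>
    rw [binomialMean_succ, ih]
    ring

theorem binomialMean_id (n : ℕ) (x : ℝ) :
    (binomialMean n x fun k => (k : ℝ)) = n * (1 - x) := by
  induction n with
  | zero => simp [binomialMean_zero]
  | succ n ih =>
    push_cast [binomialMean_succ]
    rw [binomialMean_add, ih, binomialMean_one]
    ring

theorem binomialMean_sq (n : ℕ) (x : ℝ) :
    (binomialMean n x fun k => (k : ℝ) ^ 2) =
      n * (1 - x) * x + (n * (1 - x)) ^ 2 := by
  induction n with
  | zero => simp [binomialMean_zero]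
  | succ n ih =>
    have h : (fun k : ℕ => ((k + 1 : ℕ) : ℝ) ^ 2) = fun k : ℕ => (k : ℝ) ^ 2 + (2 * k + 1) := by
      ext k
      push_cast
      ring
    rw [binomialMean_succ, h, binomialMean_add, binomialMean_add, binomialMean_smul,
      binomialMean_id, binomialMean_one, ih]
    push_cast
    ring

theorem binomialMean_single (n : ℕ) (x : ℝ) (j : ℕ) :
    (binomialMean n x fun k => if k = j then 1 else 0) = binomialProb n x j := by
  simp only [binomialMean, mul_ite, mul_one, mul_zero, Finset.sum_ite_eq']
  split_ifs with h
  · rfl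
  · rw [binomialProb_eq_zero_of_lt x (by simpa [Nat.lt_succ_iff] using h)]

/-- The coefficients `1, 1, 0` encode `s + 1`, the length after `s` turns. The indicators repair the
small cases, and the nested form lets `binomialMean` be applied term by term. -/
theorem zeroTurnExpectation_mean (k : ℕ) :
    zeroTurnExpectation k (quadraticStatistic 1 1 0) 1 =
      2 / 3 * (k : ℝ) + (1 / 6 * 1 + (5 / 6 * (if k = 0 then 1 else 0) +
        1 / 6 * (if k = 1 then 1 else 0))) := by
  match k with
  | 0 => rw [zeroTurnExpectation_zero_quadratic]; norm_num
  | 1 => rw [zeroTurnExpectation_one_quadratic]; norm_num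
  | 2 => rw [zeroTurnExpectation_two_quadratic]; norm_num
  | 3 => rw [zeroTurnExpectation_three_quadratic]; norm_num
  | k + 4 =>
    rw [zeroTurnExpectation_add_four_quadratic, if_neg (by omega), if_neg (by omega)]
    push_cast
    ring

theorem zeroTurnExpectation_sq (k : ℕ) :
    zeroTurnExpectation k (quadraticStatistic 1 2 1) 1 =
      4 / 9 * (k : ℝ) ^ 2 + (2 / 5 * (k : ℝ) + (-2 / 45 * 1 +
        (47 / 45 * (if k = 0 then 1 else 0) + (1 / 5 * (if k = 1 then 1 else 0) +
          (-1 / 30 * (if k = 2 then 1 else 0) + 1 / 90 * (if k = 3 then 1 else 0)))))) := by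
  match k with
  | 0 => rw [zeroTurnExpectation_zero_quadratic]; norm_num
  | 1 => rw [zeroTurnExpectation_one_quadratic]; norm_num
  | 2 => rw [zeroTurnExpectation_two_quadratic]; norm_num
  | 3 => rw [zeroTurnExpectation_three_quadratic]; norm_num
  | k + 4 =>
    rw [zeroTurnExpectation_add_four_quadratic, if_neg (by omega), if_neg (by omega),
      if_neg (by omega), if_neg (by omega)]
    push_cast
    ring

theorem meanL_succ {x : ℝ} (hx0 : 0 ≤ x) (hx1 : x < 1) (n : ℕ) :
    meanL (n + 1) x = 2 / 3 * (n + 1 : ℕ) * (1 - x) + 1 / 6 +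
      firstMomentCorrection (n + 1) x := by
  have hg : (fun s : ℕ => ((s + 1 : ℕ) : ℝ)) = quadraticStatistic 1 1 0 := by
    ext s
    simp [quadraticStatistic, add_comm]
  rw [meanL, integral_longestXAlternating_eq_binomialMean hx0 hx1 n fun s => (s : ℝ), hg]
  simp only [zeroTurnExpectation_mean, binomialMean_add, binomialMean_smul, binomialMean_id,
    binomialMean_one, binomialMean_single, firstMomentCorrection]
  ring

theorem integral_longestXAlternating_sq {x : ℝ} (hx0 : 0 ≤ x) (hx1 : x < 1) (n : ℕ) :
    ∫ y, (longestXAlternating x y : ℝ) ^ 2 ∂(cubeMeasure (n + 1)) =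
      4 / 9 * ((n + 1 : ℕ) * (1 - x) * x + ((n + 1 : ℕ) * (1 - x)) ^ 2) +
        2 / 5 * ((n + 1 : ℕ) * (1 - x)) - 2 / 45 + secondMomentCorrection (n + 1) x := by
  have hg : (fun s : ℕ => ((s + 1 : ℕ) : ℝ) ^ 2) = quadraticStatistic 1 2 1 := by
    ext s
    simp only [quadraticStatistic]
    push_cast
    ring
  rw [integral_longestXAlternating_eq_binomialMean hx0 hx1 n fun s => (s : ℝ) ^ 2, hg]
  simp only [zeroTurnExpectation_sq, binomialMean_add, binomialMean_smul, binomialMean_id,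
    binomialMean_sq, binomialMean_one, binomialMean_single, secondMomentCorrection]
  ring

theorem varL_succ {x : ℝ} (hx0 : 0 ≤ x) (hx1 : x < 1) (n : ℕ) :
    varL (n + 1) x = (1 - x) * (2 + 5 * x) * (4 * (n + 1 : ℕ) / 45) - 13 / 180
      + secondMomentCorrection (n + 1) x
      - 2 * (2 / 3 * (n + 1 : ℕ) * (1 - x) + 1 / 6) * firstMomentCorrection (n + 1) x
      - firstMomentCorrection (n + 1) x ^ 2 := by
  have hmeas : Measurable fun y : Fin (n + 1) → ℝ => (longestXAlternating x y : ℝ) :=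
    (measurable_from_nat (f := fun s : ℕ => (s : ℝ))).comp (measurable_longestXAlternating hx0 n)
  have hmem : MemLp (fun y : Fin (n + 1) → ℝ => (longestXAlternating x y : ℝ)) 2
      (cubeMeasure (n + 1)) := by
    rw [memLp_two_iff_integrable_sq hmeas.aestronglyMeasurable]
    exact integrable_comp_of_le (measurable_longestXAlternating hx0 n)
      (longestXAlternating_le hx0 n) fun s => (s : ℝ) ^ 2
  rw [varL, variance_eq_sub hmem]
  have h1 := meanL_succ hx0 hx1 n
  have h2 := integral_longestXAlternating_sq hx0 hx1 n
  rw [meanL] at h1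
  simp only [Pi.pow_apply]
  rw [h1, h2]
  ring

/-! ### Asymptotics -/

/-- The factor `n` is needed because the variance contains the mean times the first-moment
correction. Exponential decay of `x ^ n` beats any power of `n`. -/
theorem tendsto_mul_binomialProb {x : ℝ} (hx0 : 0 ≤ x) (hx1 : x < 1) (j : ℕ) :
    Tendsto (fun n : ℕ => (n : ℝ) * binomialProb n x j) atTop (𝓝 0) := by
  -- With `n = m + j` the truncated exponent `n - j` becomes `m`.
  rw [← tendsto_add_atTop_iff_nat j]
  have hlim : Tendsto (fun m : ℕ => ((j : ℝ) + 1) ^ (j + 1) * ((m : ℝ) ^ (j + 1) * x ^ m))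
      atTop (𝓝 0) := by
    simpa using (tendsto_pow_const_mul_const_pow_of_abs_lt_one (j + 1)
      (abs_lt.2 ⟨by linarith, hx1⟩ : |x| < 1)).const_mul (((j : ℝ) + 1) ^ (j + 1))
  refine squeeze_zero' (Eventually.of_forall fun m => ?_) ?_ hlim
  · have : 0 ≤ 1 - x := by linarith
    unfold binomialProb
    positivity
  · filter_upwards [eventually_ge_atTop 1] with m hm
    have h1 : ((m + j).choose j : ℝ) ≤ ((m + j : ℕ) : ℝ) ^ j := by
      exact_mod_cast Nat.choose_le_pow (m + j) j
    have h2 : ((m + j : ℕ) : ℝ) ≤ ((j : ℝ) + 1) * m := by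
      have : (1 : ℝ) ≤ m := by exact_mod_cast hm
      push_cast
      nlinarith [(Nat.cast_nonneg j : (0 : ℝ) ≤ j)]
    have h3 : (1 - x) ^ j ≤ 1 := pow_le_one₀ (by linarith) (by linarith)
    have h4 : (0 : ℝ) ≤ x ^ m := pow_nonneg hx0 m
    rw [binomialProb, Nat.add_sub_cancel]
    calc ((m + j : ℕ) : ℝ) * (((m + j).choose j : ℝ) * (1 - x) ^ j * x ^ m)
        ≤ ((m + j : ℕ) : ℝ) * (((m + j : ℕ) : ℝ) ^ j * 1 * x ^ m) := by
          have : 0 ≤ 1 - x := by linarith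
          gcongr
      _ = ((m + j : ℕ) : ℝ) ^ (j + 1) * x ^ m := by ring
      _ ≤ (((j : ℝ) + 1) * m) ^ (j + 1) * x ^ m := by gcongr
      _ = ((j : ℝ) + 1) ^ (j + 1) * ((m : ℝ) ^ (j + 1) * x ^ m) := by rw [mul_pow, mul_assoc]

theorem tendsto_binomialProb {x : ℝ} (hx0 : 0 ≤ x) (hx1 : x < 1) (j : ℕ) :
    Tendsto (fun n : ℕ => binomialProb n x j) atTop (𝓝 0) := by
  have hnn : ∀ n, 0 ≤ binomialProb n x j := fun n => by
    have : 0 ≤ 1 - x := by linarith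
    unfold binomialProb
    positivity
  refine squeeze_zero' (Eventually.of_forall hnn) ?_ (tendsto_mul_binomialProb hx0 hx1 j)
  filter_upwards [eventually_ge_atTop 1] with n hn
  exact le_mul_of_one_le_left (hnn n) (by exact_mod_cast hn)

theorem tendsto_firstMomentCorrection {x : ℝ} (hx0 : 0 ≤ x) (hx1 : x < 1) :
    Tendsto (fun n : ℕ => firstMomentCorrection n x) atTop (𝓝 0) := by
  have h := tendsto_binomialProb hx0 hx1
  have := ((h 0).const_mul (5 / 6)).add ((h 1).const_mul (1 / 6))
  simp only [mul_zero, add_zero] at this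
  exact this

theorem tendsto_mul_firstMomentCorrection {x : ℝ} (hx0 : 0 ≤ x) (hx1 : x < 1) :
    Tendsto (fun n : ℕ => (n : ℝ) * firstMomentCorrection n x) atTop (𝓝 0) := by
  have h := tendsto_mul_binomialProb hx0 hx1
  have := ((h 0).const_mul (5 / 6)).add ((h 1).const_mul (1 / 6))
  simp only [mul_zero, add_zero] at this
  refine this.congr fun n => ?_
  rw [firstMomentCorrection]
  ring

theorem tendsto_secondMomentCorrection {x : ℝ} (hx0 : 0 ≤ x) (hx1 : x < 1) :
    Tendsto (fun n : ℕ => secondMomentCorrection n x) atTop (𝓝 0) := by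
  have h := tendsto_binomialProb hx0 hx1
  have := ((((h 0).const_mul (47 / 45)).add ((h 1).const_mul (1 / 5))).sub
    ((h 2).const_mul (1 / 30))).add ((h 3).const_mul (1 / 90))
  simp only [mul_zero, add_zero, sub_zero] at this
  exact this

theorem corollary3 (x : ℝ) (hx0 : 0 ≤ x) (hx1 : x < 1) :
    (∀ n : ℕ, 1 ≤ n →
      Measurable (fun y : Fin n → ℝ => longestXAlternating x y) ∧
      meanL n x = 2 / 3 * n * (1 - x) + 1 / 6 + firstMomentCorrection n x ∧
      varL n x = (1 - x) * (2 + 5 * x) * (4 * n / 45) - 13 / 180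
        + secondMomentCorrection n x
        - 2 * (2 / 3 * n * (1 - x) + 1 / 6) * firstMomentCorrection n x
        - firstMomentCorrection n x ^ 2) ∧
    Tendsto (fun n : ℕ => meanL n x - (2 / 3 * n * (1 - x) + 1 / 6)) atTop (𝓝 0) ∧
    Tendsto (fun n : ℕ => varL n x - ((1 - x) * (2 + 5 * x) * (4 * n / 45) - 13 / 180))
      atTop (𝓝 0) := by
  refine ⟨fun n hn => ?_, ?_, ?_⟩
  · obtain ⟨m, rfl⟩ := Nat.exists_eq_add_of_le' hn
    exact ⟨measurable_longestXAlternating hx0 m, meanL_succ hx0 hx1 m, varL_succ hx0 hx1 m⟩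
  · refine (tendsto_firstMomentCorrection hx0 hx1).congr' ?_
    filter_upwards [eventually_ge_atTop 1] with n hn
    obtain ⟨m, rfl⟩ := Nat.exists_eq_add_of_le' hn
    rw [meanL_succ hx0 hx1]
    ring
  · have h1 := tendsto_firstMomentCorrection hx0 hx1
    -- The constants come from expanding `2 * (2 / 3 * n * (1 - x) + 1 / 6)` into `4 / 3 * (1 - x) *
    -- n + 1 / 3`.
    have h := (((tendsto_secondMomentCorrection hx0 hx1).sub
      ((tendsto_mul_firstMomentCorrection hx0 hx1).const_mul (4 / 3 * (1 - x)))).sub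
      (h1.const_mul (1 / 3))).sub (h1.pow 2)
    simp only [mul_zero, sub_zero, ne_eq, OfNat.ofNat_ne_zero, not_false_eq_true,
      zero_pow] at h
    refine h.congr' ?_
    filter_upwards [eventually_ge_atTop 1] with n hn
    obtain ⟨m, rfl⟩ := Nat.exists_eq_add_of_le' hn
    rw [varL_succ hx0 hx1]
    ring
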